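/- **Theorem (Selective overdamping).** Let $\alpha,\eta,\theta,R$ be real $N\times N$ matrices with $\alpha^{T}=\alpha>0$, $\eta^{T}=\eta\ge 0$, $\theta^{T}=-\theta$, $R^{T}=R\ge 0$, and $N_R:=\operatorname{rank}R>0$. Put $K_p=\sqrt{\alpha}^{\,-1}$, $\Phi=\sqrt{\eta}\,K_p^{T}$ and $$A(\beta)=\Omega-\mathrm i\beta B,\qquad \Omega=\begin{bmatrix}-2\mathrm i K_p\theta K_p^{T} & -\mathrm i\Phi^{T}\\ \mathrm i\Phi & 0\end{bmatrix},\qquad B=\begin{bmatrix}K_pRK_p^{T}&0\\0&0\end{bmatrix}.$$ Assume the generic condition: the eigenvalues $b_1,\dots,b_{N_R}$ of the restriction of $B$ to $\operatorname{Ran}B$, counted with multiplicity (equivalently, the nonzero eigenvalues of $\alpha^{-1}R$), are pairwise distinct. Call functions $\zeta_1,\dots,\zeta_{2N}$ of $\beta$ an *eigenvalue family* if for all sufficiently large $\beta$ the numbers $\zeta_1(\beta),\dots,\zeta_{2N}(\beta)$ are the eigenvalues of $A(\beta)$ counted with algebraic multiplicity, $|\zeta_j(\beta)|\to\infty$ as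 $\beta\to\infty$ for $1\le j\le N_R$ (high-loss), and $\zeta_j(\beta)$ has a finite limit as $\beta\to\infty$ for $N_R+1\le j\le 2N$ (low-loss). Then eigenvalue families exist, and for every eigenvalue family the following holds. 1. For all sufficiently large $\beta$, $\operatorname{Re}\zeta_j(\beta)=0$ for $1\le j\le N_R$; that is, all high-loss eigenvalues are overdamped. 2. Suppose in addition that $\operatorname{Ker}R\cap\operatorname{Ker}\eta=\{0\}$. Then the family can be reindexed, as an eigenvalue family, so that $\lim_{\beta\to\infty}\zeta_j(\beta)=0$ for $N_R+1\le j\le 2N_R$ and $\lim_{\beta\to\infty}\zeta_j(\beta)=\rho_j\neq 0$ for $2N_R+1\le j\le 2N$; and for every such indexing, $\operatorname{Re}\zeta_j(\beta)\ne 0$ for $2N_R+1\le j\le 2N$ and all sufficiently large $\beta$, while $\lim_{\beta\to\infty}\operatorname{Re}\zeta_j(\beta)=0$ for $N_R+1\le j\le 2N_R$. -/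

import Mathlib

open Filter Topology Polynomial
open scoped MatrixOrder

namespace SelectiveOverdamping

noncomputable section

/-- Real matrices regarded as complex matrices. -/
def toC {m n : Type*} (M : Matrix m n ℝ) : Matrix m n ℂ := M.map (fun x : ℝ => (x : ℂ))

/-- `K_p = (√α)⁻¹`, with `√α` the positive square root of `α`. -/
def Kp {N : ℕ} (α : Matrix (Fin N) (Fin N) ℝ) : Matrix (Fin N) (Fin N) ℝ := (CFC.sqrt α)⁻¹

/-- `K_q = √η`, the positive semidefinite square root of `η`. -/
def Kq {N : ℕ} (η : Matrix (Fin N) (Fin N) ℝ) : Matrix (Fin N) (Fin N) ℝ := CFC.sqrt η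

/-- `Φ = K_q K_pᵀ`. -/
def Phi {N : ℕ} (α η : Matrix (Fin N) (Fin N) ℝ) : Matrix (Fin N) (Fin N) ℝ :=
  Kq η * (Kp α).transpose

/-- The frequency operator `Ω = [[-2i K_p θ K_pᵀ, -i Φᵀ], [i Φ, 0]]`. -/
def Omega {N : ℕ} (α η θ : Matrix (Fin N) (Fin N) ℝ) :
    Matrix (Fin N ⊕ Fin N) (Fin N ⊕ Fin N) ℂ :=
  Matrix.fromBlocks
    ((-(2 * Complex.I)) • toC (Kp α * θ * (Kp α).transpose))
    ((-Complex.I) • toC (Phi α η).transpose)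
    (Complex.I • toC (Phi α η))
    0

/-- The dissipation operator `B = [[K_p R K_pᵀ, 0], [0, 0]]`. -/
def lossB {N : ℕ} (α R : Matrix (Fin N) (Fin N) ℝ) :
    Matrix (Fin N ⊕ Fin N) (Fin N ⊕ Fin N) ℂ :=
  Matrix.fromBlocks (toC (Kp α * R * (Kp α).transpose)) 0 0 0

/-- The system operator `A(β) = Ω - i β B`. -/
def systemOp {N : ℕ} (α η θ R : Matrix (Fin N) (Fin N) ℝ) (β : ℝ) :
    Matrix (Fin N ⊕ Fin N) (Fin N ⊕ Fin N) ℂ :=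
  Omega α η θ - (Complex.I * (β : ℂ)) • lossB α R

/-- The loss subspace `H_B = Ran B`. -/
def lossSubspace {N : ℕ} (α R : Matrix (Fin N) (Fin N) ℝ) :
    Submodule ℂ (Fin N ⊕ Fin N → ℂ) :=
  LinearMap.range (lossB α R).mulVecLin

/-- The operator `B₂ : H_B → H_B` induced by `B` on the loss subspace. -/
def lossB2 {N : ℕ} (α R : Matrix (Fin N) (Fin N) ℝ) :
    lossSubspace α R →ₗ[ℂ] lossSubspace α R :=
  (lossB α R).mulVecLin.restrict (fun x _ => LinearMap.mem_range_self _ x)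

/-- The generic condition: the eigenvalues `b₁, …, b_{N_R}` of `B₂`, listed with multiplicity
(these are the nonzero eigenvalues of `α⁻¹ R`), are pairwise distinct. -/
def GenericCondition {N : ℕ} (α R : Matrix (Fin N) (Fin N) ℝ) : Prop :=
  (lossB2 α R).charpoly.roots.Nodup

/-- A function of the loss parameter is of high-loss type if its modulus tends to infinity. -/
def IsHighLoss (z : ℝ → ℂ) : Prop := Tendsto (fun β => ‖z β‖) atTop atTop

/-- A function of the loss parameter is of low-loss type if it has a finite limit. -/
def IsLowLoss (z : ℝ → ℂ) : Prop := ∃ ρ : ℂ, Tendsto z atTop (𝓝 ρ)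

/-- `ζ₁, …, ζ_{2N}` are eigenvalue functions of `A`: for all large `β` the numbers `ζ_j(β)` are
the eigenvalues of `A(β)` counted with (algebraic) multiplicity; the first `r` of these functions
are of high-loss type and the others are of low-loss type. -/
structure IsEigenvalueFamily {N : ℕ} (A : ℝ → Matrix (Fin N ⊕ Fin N) (Fin N ⊕ Fin N) ℂ) (r : ℕ)
    (ζ : Fin (2 * N) → ℝ → ℂ) : Prop where
  charpoly_eq : ∀ᶠ β in atTop, (A β).charpoly = ∏ j, (X - C (ζ j β))
  high : ∀ j : Fin (2 * N), (j : ℕ) < r → IsHighLoss (ζ j)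
  low : ∀ j : Fin (2 * N), r ≤ (j : ℕ) → IsLowLoss (ζ j)

/-- The refined indexing of the low-loss eigenvalue functions: those with (one-based) index
`r + 1, …, 2r` tend to zero, those with index `2r + 1, …, 2N` have a nonzero limit. -/
structure IsRefinedIndexing {N : ℕ} (r : ℕ) (ζ : Fin (2 * N) → ℝ → ℂ) : Prop where
  limit_zero : ∀ j : Fin (2 * N), r ≤ (j : ℕ) → (j : ℕ) < 2 * r → Tendsto (ζ j) atTop (𝓝 0)
  limit_ne_zero : ∀ j : Fin (2 * N), 2 * r ≤ (j : ℕ) →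
    ∃ ρ : ℂ, ρ ≠ 0 ∧ Tendsto (ζ j) atTop (𝓝 ρ)

end

end SelectiveOverdamping

/-!
A unitary change of basis turns `A(β)` into `W + c • D` with `D` diagonal and `c = -iβ`. After
division by `c` this converges to `D`, so by continuity of the roots each eigenvalue of `A(β)` is
`c * (b + o(1))` for an eigenvalue `b` of `B`; cancelling the factors with `b ≠ 0` from the
characteristic polynomial, the remaining eigenvalues converge to those of the compression of `Ω` to
`Ker B`.

Since `A(β)` is `i` times a real matrix, its spectrum is symmetric under `z ↦ -conj z`. This
reflection preserves the limit `b` of `z / c`, hence fixes every high-loss eigenvalue when the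
`b ≠ 0` are simple: high-loss eigenvalues are purely imaginary.

The compression of `Ω` to `Ker B` is Hermitian, so the low-loss limits are real. It has the block
form `[[*, Fᴴ], [F, 0]]`, where `F` is injective because `Ker R ∩ Ker η = 0`; its rank is
therefore `2(N - N_R)`, which counts the nonzero limits.
-/

namespace SelectiveOverdamping

/-! ### Reindexing finite families -/

section Reindexing

variable {ι κ : Type*} [Fintype ι] [Fintype κ]

lemma exists_equiv_of_map_univ_eq {γ : Type*} {f : ι → γ} {g : κ → γ}
    (h : Multiset.map f Finset.univ.val = Multiset.map g Finset.univ.val) :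
    ∃ e : ι ≃ κ, ∀ i, g (e i) = f i := by
  classical
  have fiber_equiv (c : γ) : Nonempty ({i // f i = c} ≃ {k // g k = c}) := by
    rw [← Fintype.card_eq, Fintype.card_subtype, Fintype.card_subtype]
    have hcount := congrArg (Multiset.count c) h
    rw [Multiset.count_map, Multiset.count_map] at hcount
    simpa [Finset.card_def, Finset.filter_val, eq_comm] using hcount
  exact ⟨Equiv.ofFiberEquiv fun c => (fiber_equiv c).some, fun i => Equiv.ofFiberEquiv_map _ i⟩

lemma exists_equiv_forall_iff {p : ι → Prop} {q : κ → Prop} [DecidablePred p] [DecidablePred q]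
    (h : Fintype.card ι = Fintype.card κ)
    (hpq : Fintype.card {i // p i} = Fintype.card {k // q k}) :
    ∃ e : ι ≃ κ, ∀ i, q (e i) ↔ p i := by
  have hcompl : Fintype.card {i // ¬ p i} = Fintype.card {k // ¬ q k} := by
    rw [Fintype.card_subtype_compl, Fintype.card_subtype_compl, h, hpq]
  let e := (Equiv.sumCompl p).symm.trans <|
    ((Fintype.equivOfCardEq hpq).sumCongr (Fintype.equivOfCardEq hcompl)).trans (Equiv.sumCompl q)
  refine ⟨e, fun i => ?_⟩
  by_cases hi : p i
  · simpa [e, hi] using (Fintype.equivOfCardEq hpq ⟨i, hi⟩).2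
  · simpa [e, hi] using (Fintype.equivOfCardEq hcompl ⟨i, hi⟩).2

lemma exists_equiv_of_prod_X_sub_C_eq {K : Type*} [CommRing K] [IsDomain K] {y : ι → K} {w : κ → K}
    (h : ∏ i, (X - C (y i)) = ∏ k, (X - C (w k))) : ∃ e : ι ≃ κ, ∀ i, w (e i) = y i := by
  apply exists_equiv_of_map_univ_eq
  have hroots := congrArg roots h
  rw [roots_prod _ _ (Finset.prod_ne_zero_iff.2 fun i _ => X_sub_C_ne_zero (y i)),
    roots_prod _ _ (Finset.prod_ne_zero_iff.2 fun k _ => X_sub_C_ne_zero (w k))] at hroots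
  simpa using hroots

end Reindexing

/-! ### Limits of the roots of a polynomial -/

section Roots

lemma exists_eq_prod_X_sub_C {K ι : Type*} [Field K] [IsAlgClosed K] [Fintype ι] {p : K[X]}
    (hp : p.Monic) (hdeg : p.natDegree = Fintype.card ι) :
    ∃ y : ι → K, p = ∏ i, (X - C (y i)) := by
  have hsplits := IsAlgClosed.splits p
  have hlen : p.roots.toList.length = Fintype.card ι := by
    rw [Multiset.length_toList, ← hsplits.natDegree_eq_card_roots, hdeg]
  let e : ι ≃ Fin p.roots.toList.length := Fintype.equivFinOfCardEq hlen.symm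
  refine ⟨fun i => p.roots.toList.get (e i), ?_⟩
  rw [e.prod_comp fun k => X - C (p.roots.toList.get k)]
  conv_lhs => rw [hsplits.eq_prod_roots_of_monic hp, ← p.roots.coe_toList]
  rw [← List.prod_ofFn, Multiset.map_coe, Multiset.prod_coe]
  exact congrArg List.prod (List.ofFn_getElem_eq_map p.roots.toList fun a => X - C a).symm

variable {K T : Type*} {l : Filter T}

lemma eq_of_monic_of_tendsto_smul_eval [Field K] [Infinite K] [TopologicalSpace K] [T2Space K]
    [ContinuousMul K] [l.NeBot] {F : K → T → K} {s s' : T → K} {p q : K[X]}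
    (hp : p.Monic) (hq : q.Monic)
    (hFp : ∀ x, Tendsto (fun t => s t * F x t) l (𝓝 (p.eval x)))
    (hFq : ∀ x, Tendsto (fun t => s' t * F x t) l (𝓝 (q.eval x))) : p = q := by
  have cross (x y : K) : p.eval x * q.eval y = q.eval x * p.eval y := by
    refine tendsto_nhds_unique ((hFp x).mul (hFq y)) (((hFq x).mul (hFp y)).congr fun t => ?_)
    ring
  refine Polynomial.funext fun y => ?_
  have hpoly : C (q.eval y) * p = C (p.eval y) * q :=
    Polynomial.funext fun x => by simpa [mul_comm] using cross x y
  simpa [hp.leadingCoeff, hq.leadingCoeff] using (congrArg leadingCoeff hpoly).symm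

variable [NormedField K]

lemma tendsto_sub_div_neg {z : T → K} (hz : Tendsto z l (Bornology.cobounded K)) (x : K) :
    Tendsto (fun t => (x - z t) / -z t) l (𝓝 1) := by
  have hlim : Tendsto (fun t => 1 - x * (z t)⁻¹) l (𝓝 1) := by
    simpa using ((tendsto_inv₀_cobounded.comp hz).const_mul x).const_sub 1
  refine hlim.congr' ?_
  filter_upwards [hz.eventually_ne_cobounded 0] with t ht
  field_simp
  ring

/-- The unbounded factors `x - z i t` are equivalent to `-z i t`, which does not depend on `x`, so
after rescaling only the bounded roots contribute to the limit. -/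
lemma prod_X_sub_C_eq_of_tendsto_smul_prod [Infinite K] [l.NeBot] {ι : Type*} [Fintype ι]
    {z : ι → T → K} {p : ι → Prop} [DecidablePred p] {y : {i // p i} → K} {s : T → K} {q : K[X]}
    (hq : q.Monic) (hlim : ∀ x, Tendsto (fun t => s t * ∏ i, (x - z i t)) l (𝓝 (q.eval x)))
    (hbdd : ∀ i : {i // p i}, Tendsto (z i) l (𝓝 (y i)))
    (hunbdd : ∀ i, ¬ p i → Tendsto (z i) l (Bornology.cobounded K)) :
    ∏ i, (X - C (y i)) = q := by
  refine eq_of_monic_of_tendsto_smul_eval (F := fun x t => ∏ i, (x - z i t))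
    (s := fun t => (∏ i : {i // ¬ p i}, -z i t)⁻¹) (monic_prod_X_sub_C _ _) hq (fun x => ?_) hlim
  have hlow : Tendsto (fun t => ∏ i : {i // p i}, (x - z i t)) l (𝓝 (∏ i, (x - y i))) :=
    tendsto_finsetProd _ fun i _ => (hbdd i).const_sub x
  have hhigh : Tendsto (fun t => ∏ i : {i // ¬ p i}, (x - z i t) / -z i t) l (𝓝 (∏ _i, 1)) :=
    tendsto_finsetProd _ fun i _ => tendsto_sub_div_neg (hunbdd i i.2) x
  convert hhigh.mul hlow using 2 with t
  · rw [← Fintype.prod_subtype_mul_prod_subtype p, Finset.prod_div_distrib]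
    ring
  · simp [eval_prod]

variable [ProperSpace K]

lemma tendsto_cobounded_or_exists_tendsto_nhds (g : Ultrafilter T) (z : T → K) :
    Tendsto z g (Bornology.cobounded K) ∨ ∃ y, Tendsto z g (𝓝 y) := by
  by_cases h : ∃ y, Tendsto z g (𝓝 y)
  · exact .inr h
  rw [Metric.cobounded_eq_cocompact, (hasBasis_cocompact).tendsto_right_iff]
  refine .inl fun s hs => ?_
  by_contra hmem
  obtain ⟨y, -, hy⟩ := hs.ultrafilter_le_nhds (g.map z)
    (le_principal_iff.2 ((Ultrafilter.eventually_not.2 hmem).mono fun _ => not_not.1))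
  exact h ⟨y, hy⟩

/-- Along an ultrafilter every root converges or tends to infinity; comparing degrees rules out the
latter. -/
lemma exists_perm_tendsto_ultrafilter [Infinite K] {ι : Type*} [Fintype ι] {g : Ultrafilter T}
    {y : ι → T → K} {w : ι → K}
    (h : ∀ x, Tendsto (fun t => ∏ i, (x - y i t)) g (𝓝 (∏ i, (x - w i)))) :
    ∃ τ : Equiv.Perm ι, ∀ i, Tendsto (y (τ i)) g (𝓝 (w i)) := by
  classical
  let p : ι → Prop := fun i => ∃ a, Tendsto (y i) g (𝓝 a)
  choose a ha using fun i : {i // p i} => i.2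
  have hprod : ∏ i, (X - C (a i)) = ∏ i, (X - C (w i)) :=
    prod_X_sub_C_eq_of_tendsto_smul_prod (s := fun _ => 1) (monic_prod_X_sub_C _ _)
      (fun x => by simpa [eval_prod] using h x) ha
      fun i hi => (tendsto_cobounded_or_exists_tendsto_nhds g (y i)).resolve_right hi
  obtain ⟨e, he⟩ := exists_equiv_of_prod_X_sub_C_eq hprod.symm
  refine ⟨Equiv.ofBijective (fun i => (e i : ι)) (Finite.injective_iff_bijective.1
    (Subtype.val_injective.comp e.injective)), fun i => ?_⟩
  simpa [he i] using ha (e i)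

lemma exists_perm_tendsto [Infinite K] {ι : Type*} [Fintype ι] {y : ι → T → K} {w : ι → K}
    (h : ∀ x, Tendsto (fun t => ∏ i, (x - y i t)) l (𝓝 (∏ i, (x - w i)))) :
    ∃ σ : T → Equiv.Perm ι, ∀ i, Tendsto (fun t => y (σ t i) t) l (𝓝 (w i)) := by
  choose σ hσ using fun t =>
    Finite.exists_min fun σ : Equiv.Perm ι => dist (fun i => y (σ i) t) w
  suffices hlim : Tendsto (fun t i => y (σ t i) t) l (𝓝 w) from ⟨σ, tendsto_pi_nhds.1 hlim⟩
  rw [tendsto_iff_ultrafilter]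
  intro g hg
  obtain ⟨τ, hτ⟩ := exists_perm_tendsto_ultrafilter fun x => (h x).mono_left hg
  have hdist := tendsto_iff_dist_tendsto_zero.1 (tendsto_pi_nhds.2 hτ)
  exact tendsto_iff_dist_tendsto_zero.2
    (squeeze_zero (fun _ => dist_nonneg) (fun t => hσ t τ) hdist)

end Roots

/-! ### Matrix pencils with an unbounded diagonal coefficient -/

section Pencil

variable {n K T : Type*} {l : Filter T}

/-- The compression of `W` to the kernel of the loss operator `diagonal d`. -/
def losslessBlock [Zero K] (W : Matrix n n K) (d : n → K) :
    Matrix {i // d i = 0} {i // d i = 0} K :=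
  W.toSquareBlockProp fun i => d i = 0

variable [Fintype n] [DecidableEq n]

lemma det_of_ite_one [CommRing K] (M : Matrix n n K) (p : n → Prop) [DecidablePred p] :
    (Matrix.of fun i j => if p i then M i j else (1 : Matrix n n K) i j).det =
      (M.toSquareBlockProp p).det := by
  set M' : Matrix n n K := Matrix.of fun i j => if p i then M i j else (1 : Matrix n n K) i j
  have hlower (i : n) (hi : ¬ p i) (j : n) : M' i j = (1 : Matrix n n K) i j := by
    simp [M', hi]
  have hzero (i : n) (hi : ¬ p i) (j : n) (hj : p j) : M' i j = 0 := by
    rw [hlower i hi, Matrix.one_apply_ne (ne_of_mem_of_not_mem (s := {i | p i}) hj hi).symm]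
  have hupper : M'.toSquareBlockProp p = M.toSquareBlockProp p := by
    ext i j
    simp [M', Matrix.toSquareBlockProp, i.2]
  have hone : M'.toSquareBlockProp (fun i => ¬ p i) = 1 := by
    ext i j
    simp [Matrix.toSquareBlockProp, hlower i i.2, Matrix.one_apply, Subtype.ext_iff]
  rw [Matrix.twoBlockTriangular_det M' p hzero, hupper, hone, Matrix.det_one, mul_one]

lemma charpoly_smul_eq_prod {ι : Type*} [Fintype ι] [Field K] [Infinite K] {M : Matrix n n K}
    {u : ι → K} (h : M.charpoly = ∏ i, (X - C (u i))) (a : K) :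
    (a • M).charpoly = ∏ i, (X - C (a * u i)) := by
  have hcard : Fintype.card n = Fintype.card ι := by
    simpa using congrArg natDegree h
  rcases eq_or_ne a 0 with rfl | ha
  · simp [hcard]
  refine Polynomial.funext fun x => ?_
  have hscalar : Matrix.scalar n x - a • M = a • (Matrix.scalar n (a⁻¹ * x) - M) := by
    ext i j
    simp [Matrix.diagonal_apply, mul_sub, mul_inv_cancel_left₀ ha]
  have hfactor (i : ι) : x - a * u i = a * (a⁻¹ * x - u i) := by
    rw [mul_sub, mul_inv_cancel_left₀ ha]
  rw [Matrix.eval_charpoly, hscalar, Matrix.det_smul, ← Matrix.eval_charpoly, h, hcard]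
  simp [eval_prod, hfactor, Finset.prod_mul_distrib]

lemma tendsto_eval_charpoly [CommRing K] [TopologicalSpace K] [IsTopologicalRing K]
    {F : T → Matrix n n K} {M : Matrix n n K} (h : Tendsto F l (𝓝 M)) (x : K) :
    Tendsto (fun t => (F t).charpoly.eval x) l (𝓝 (M.charpoly.eval x)) := by
  simp only [Matrix.eval_charpoly]
  exact ((continuous_const.sub continuous_id).matrix_det.tendsto M).comp h

variable [NormedField K] {c : T → K}

lemma tendsto_inv_neg_mul_sub (hc : Tendsto c l (Bornology.cobounded K)) {a : K} (ha : a ≠ 0)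
    (u v : K) : Tendsto (fun t => (-(c t * a))⁻¹ * (u - c t * (a * v))) l (𝓝 v) := by
  have hlim : Tendsto (fun t => -a⁻¹ * u * (c t)⁻¹ + v) l (𝓝 v) := by
    simpa using ((tendsto_inv₀_cobounded.comp hc).const_mul (-a⁻¹ * u)).add_const v
  refine hlim.congr' ?_
  filter_upwards [hc.eventually_ne_cobounded 0] with t ht
  field_simp
  ring

lemma tendsto_smul_eval_charpoly_add_smul_diagonal [DecidableEq K]
    (hc : Tendsto c l (Bornology.cobounded K)) (W : Matrix n n K) (d : n → K) (x : K) :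
    Tendsto (fun t => (∏ i : {i // ¬ d i = 0}, -(c t * d i))⁻¹ *
      (W + c t • Matrix.diagonal d).charpoly.eval x) l
      (𝓝 ((losslessBlock W d).charpoly.eval x)) := by
  let s (t : T) (i : n) : K := if d i = 0 then 1 else (-(c t * d i))⁻¹
  let M (t : T) : Matrix n n K := Matrix.scalar n x - (W + c t • Matrix.diagonal d)
  let M' : Matrix n n K :=
    Matrix.of fun i j => if d i = 0 then (Matrix.scalar n x - W) i j else (1 : Matrix n n K) i j
  have hM' : (losslessBlock W d).charpoly.eval x = M'.det := by
    rw [det_of_ite_one, Matrix.eval_charpoly]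
    congr 1
    ext i j
    simp [losslessBlock, Matrix.toSquareBlockProp, Matrix.diagonal_apply, Subtype.ext_iff]
  have hM (t : T) : (∏ i : {i // ¬ d i = 0}, -(c t * d i))⁻¹ *
      (W + c t • Matrix.diagonal d).charpoly.eval x = (Matrix.diagonal (s t) * M t).det := by
    have hs_zero (i : {i // d i = 0}) : s t i = 1 := by simp [s, i.2]
    have hs_ne (i : {i // ¬ d i = 0}) : s t i = (-(c t * d i))⁻¹ := by simp [s, i.2]
    rw [Matrix.det_mul, Matrix.det_diagonal, Matrix.eval_charpoly,
      ← Fintype.prod_subtype_mul_prod_subtype (fun i => d i = 0)]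
    simp only [hs_zero, hs_ne, Finset.prod_const_one, one_mul, Finset.prod_inv_distrib, M]
  have hentry (i j : n) : Tendsto (fun t => s t i * M t i j) l (𝓝 (M' i j)) := by
    by_cases hi : d i = 0
    · have hconst (t : T) : s t i * M t i j = M' i j := by
        simp [s, M, M', hi, Matrix.diagonal_apply]
      simpa only [hconst] using tendsto_const_nhds
    · convert tendsto_inv_neg_mul_sub hc hi ((Matrix.scalar n x - W) i j)
        ((1 : Matrix n n K) i j) using 2 with t
      · simp [s, M, hi, Matrix.one_apply, Matrix.diagonal_apply, sub_sub]
      · simp [M', hi]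
  simp only [hM, hM']
  refine (continuous_id.matrix_det.tendsto M').comp (tendsto_pi_nhds.2 fun i =>
    tendsto_pi_nhds.2 fun j => ?_)
  simpa only [Matrix.diagonal_mul] using hentry i j

lemma tendsto_cobounded_of_tendsto_inv_mul (hc : Tendsto c l (Bornology.cobounded K))
    {z : T → K} {a : K} (ha : a ≠ 0) (hz : Tendsto (fun t => (c t)⁻¹ * z t) l (𝓝 a)) :
    Tendsto z l (Bornology.cobounded K) := by
  rw [← tendsto_norm_atTop_iff_cobounded] at hc ⊢
  refine (hc.atTop_mul_pos (norm_pos_iff.2 ha) hz.norm).congr' ?_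
  filter_upwards [hc.eventually_ne_atTop 0] with t ht
  rw [← norm_mul, mul_inv_cancel_left₀ (norm_ne_zero_iff.1 ht)]

/-- The roots of order `c t` are the `z i` with `d i ≠ 0`, each equivalent to `c t * d i`; dividing
them out of the low-loss limit of the characteristic polynomial leaves the remaining roots. -/
lemma tendsto_prod_sub_of_tendsto_inv_mul [DecidableEq K]
    (hc : Tendsto c l (Bornology.cobounded K)) {W : Matrix n n K} {d : n → K} {z : n → T → K}
    (hz : ∀ᶠ t in l, (W + c t • Matrix.diagonal d).charpoly = ∏ i, (X - C (z i t)))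
    (hlim : ∀ i, d i ≠ 0 → Tendsto (fun t => (c t)⁻¹ * z i t) l (𝓝 (d i))) (x : K) :
    Tendsto (fun t => ∏ i : {i // d i = 0}, (x - z i t)) l
      (𝓝 ((losslessBlock W d).charpoly.eval x)) := by
  have hratio (i : {i // ¬ d i = 0}) :
      Tendsto (fun t => -(c t * d i) / (x - z i t)) l (𝓝 1) := by
    have hinv : Tendsto (fun t => ((c t)⁻¹ * z i t - x * (c t)⁻¹)⁻¹ * d i) l (𝓝 1) := by
      have hsub := (hlim i i.2).sub ((tendsto_inv₀_cobounded.comp hc).const_mul x)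
      rw [mul_zero, sub_zero] at hsub
      simpa [inv_mul_cancel₀ i.2] using (hsub.inv₀ i.2).mul_const (d i)
    refine hinv.congr fun t => ?_
    rw [mul_comm x, ← mul_sub, mul_inv, inv_inv, ← neg_sub (z i t) x, div_neg, neg_div, neg_neg]
    ring
  have hprod := tendsto_finsetProd Finset.univ fun i _ => hratio i
  have hmul := hprod.mul (tendsto_smul_eval_charpoly_add_smul_diagonal hc W d x)
  rw [Finset.prod_const_one, one_mul] at hmul
  refine hmul.congr' ?_
  have hne (i : {i // ¬ d i = 0}) : ∀ᶠ t in l, x - z i t ≠ 0 :=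
    ((tendsto_cobounded_of_tendsto_inv_mul hc i.2 (hlim i i.2)).eventually_ne_cobounded x).mono
      fun t ht => sub_ne_zero.2 ht.symm
  filter_upwards [hz, hc.eventually_ne_cobounded 0, eventually_all.2 hne] with t ht hct hzt
  have hhigh : ∏ i : {i // ¬ d i = 0}, (x - z i t) ≠ 0 := Finset.prod_ne_zero_iff.2 fun i _ => hzt i
  have hscale : ∏ i : {i // ¬ d i = 0}, -(c t * d i) ≠ 0 :=
    Finset.prod_ne_zero_iff.2 fun i _ => neg_ne_zero.2 (mul_ne_zero hct i.2)
  rw [ht, eval_prod, ← Fintype.prod_subtype_mul_prod_subtype (fun i => d i = 0),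
    Finset.prod_div_distrib]
  simp only [eval_sub, eval_X, eval_C]
  field_simp

variable [IsAlgClosed K] [ProperSpace K]

lemma exists_scaled_roots_charpoly_add_smul_diagonal (hc : Tendsto c l (Bornology.cobounded K))
    (W : Matrix n n K) (d : n → K) :
    ∃ z : n → T → K,
      (∀ᶠ t in l, (W + c t • Matrix.diagonal d).charpoly = ∏ i, (X - C (z i t))) ∧
      ∀ i, Tendsto (fun t => (c t)⁻¹ * z i t) l (𝓝 (d i)) := by
  let F (t : T) : Matrix n n K := (c t)⁻¹ • W + Matrix.diagonal d
  have hF : Tendsto F l (𝓝 (Matrix.diagonal d)) := by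
    simpa using ((tendsto_inv₀_cobounded.comp hc).smul_const W).add_const (Matrix.diagonal d)
  choose u hu using fun t =>
    exists_eq_prod_X_sub_C (F t).charpoly_monic (F t).charpoly_natDegree_eq_dim
  have heval (x : K) : Tendsto (fun t => ∏ i, (x - u t i)) l (𝓝 (∏ i, (x - d i))) := by
    simpa [hu, Matrix.charpoly_diagonal, eval_prod] using tendsto_eval_charpoly hF x
  obtain ⟨σ, hσ⟩ := exists_perm_tendsto (y := fun i t => u t i) heval
  refine ⟨fun i t => c t * u t (σ t i), ?_, fun i => (hσ i).congr' ?_⟩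
  · filter_upwards [hc.eventually_ne_cobounded 0] with t ht
    have hsmul : W + c t • Matrix.diagonal d = c t • F t := by
      simp [F, smul_add, smul_smul, ht]
    rw [hsmul, charpoly_smul_eq_prod (hu t), ← Equiv.prod_comp (σ t)]
  · filter_upwards [hc.eventually_ne_cobounded 0] with t ht
    rw [inv_mul_cancel_left₀ ht]

theorem exists_roots_charpoly_add_smul_diagonal (hc : Tendsto c l (Bornology.cobounded K))
    (W : Matrix n n K) (d : n → K) :
    ∃ z : n → T → K,
      (∀ᶠ t in l, (W + c t • Matrix.diagonal d).charpoly = ∏ i, (X - C (z i t))) ∧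
      (∀ i, Tendsto (fun t => (c t)⁻¹ * z i t) l (𝓝 (d i))) ∧
      ∀ i, d i = 0 → ∃ w, Tendsto (z i) l (𝓝 w) := by
  classical
  obtain ⟨z, hz, hlim⟩ := exists_scaled_roots_charpoly_add_smul_diagonal hc W d
  obtain ⟨w, hw⟩ := exists_eq_prod_X_sub_C (losslessBlock W d).charpoly_monic
    (losslessBlock W d).charpoly_natDegree_eq_dim
  have hlow (x : K) : Tendsto (fun t => ∏ i : {i // d i = 0}, (x - z i t)) l
      (𝓝 (∏ i, (x - w i))) := by
    simpa [hw, eval_prod] using tendsto_prod_sub_of_tendsto_inv_mul hc hz (fun i _ => hlim i) x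
  obtain ⟨σ, hσ⟩ := exists_perm_tendsto (y := fun (i : {i // d i = 0}) t => z i t) hlow
  refine ⟨fun i t => if h : d i = 0 then z (σ t ⟨i, h⟩) t else z i t, ?_, fun i => ?_,
    fun i hi => ⟨w ⟨i, hi⟩, ?_⟩⟩
  · filter_upwards [hz] with t ht
    rw [ht, ← Fintype.prod_subtype_mul_prod_subtype (fun i => d i = 0),
      ← Fintype.prod_subtype_mul_prod_subtype (fun i => d i = 0), ← Equiv.prod_comp (σ t)]
    congr 1 <;> exact Finset.prod_congr rfl fun i _ => by simp [i.2]
  · by_cases hi : d i = 0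
    · simpa [hi] using (tendsto_inv₀_cobounded.comp hc).mul (hσ ⟨i, hi⟩)
    · simpa [hi] using hlim i
  · simpa [hi] using hσ ⟨i, hi⟩

end Pencil

/-! ### Overdamping -/

section Overdamping

open ComplexConjugate

variable {n T : Type*} {l : Filter T} {c : T → ℂ} {d : n → ℂ}

lemma eventually_ne_of_disjoint {Y : Type*} {f g : T → Y} {a b : Filter Y} (hf : Tendsto f l a)
    (hg : Tendsto g l b) (hab : Disjoint a b) : ∀ᶠ t in l, f t ≠ g t := by
  obtain ⟨s, hs, u, hu, hsu⟩ := Filter.disjoint_iff.1 hab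
  filter_upwards [hf hs, hg hu] with t htf htg
  exact hsu.ne_of_mem htf htg

/-- The reflection `z ↦ -conj z` acts on `z / c` as complex conjugation, so it sends the root with
`z / c → d i` to a root with the same limit; simplicity of `d i` makes these the same root. -/
lemma eventually_neg_conj_eq_self [Finite n] (hconj : ∀ t, conj (c t) = -c t)
    {z : n → T → ℂ} {i : n} (hi : conj (d i) = d i) (hsimple : ∀ j, d j = d i → j = i)
    (hlim : ∀ j, Tendsto (fun t => (c t)⁻¹ * z j t) l (𝓝 (d j)))
    (hsymm : ∀ᶠ t in l, ∃ j, z j t = -conj (z i t)) :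
    ∀ᶠ t in l, -conj (z i t) = z i t := by
  have hreflect : Tendsto (fun t => (c t)⁻¹ * -conj (z i t)) l (𝓝 (d i)) := by
    have h := (Complex.continuous_conj.tendsto _).comp (hlim i)
    rw [hi] at h
    refine h.congr fun t => ?_
    simp [hconj]
  have hne (j : n) : ∀ᶠ t in l, z j t = -conj (z i t) → j = i := by
    by_cases hj : j = i
    · simp [hj]
    · filter_upwards [eventually_ne_of_disjoint (hlim j) hreflect
        (disjoint_nhds_nhds.2 fun h => hj (hsimple j h))] with t ht hz
      exact absurd (congrArg _ hz) ht
  filter_upwards [hsymm, eventually_all.2 hne] with t ⟨j, hj⟩ ht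
  rw [← hj, ht j hj]

theorem eventually_re_eq_zero_of_tendsto_cobounded [Fintype n] [DecidableEq n]
    {W : Matrix n n ℂ} (hc : Tendsto c l (Bornology.cobounded ℂ))
    (hconj : ∀ t, conj (c t) = -c t) (hd : ∀ i, conj (d i) = d i)
    (hsimple : ∀ i j, d i ≠ 0 → d j = d i → j = i)
    (hsymm : ∀ t z, (W + c t • Matrix.diagonal d).charpoly.IsRoot z →
      (W + c t • Matrix.diagonal d).charpoly.IsRoot (-conj z))
    {ζ : T → ℂ} (hζ : Tendsto ζ l (Bornology.cobounded ℂ))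
    (hroot : ∀ᶠ t in l, (W + c t • Matrix.diagonal d).charpoly.IsRoot (ζ t)) :
    ∀ᶠ t in l, (ζ t).re = 0 := by
  obtain ⟨z, hz, hlim, hlow⟩ := exists_roots_charpoly_add_smul_diagonal hc W d
  have isRoot_iff {t : T} (ht : (W + c t • Matrix.diagonal d).charpoly = ∏ i, (X - C (z i t)))
      (a : ℂ) : (W + c t • Matrix.diagonal d).charpoly.IsRoot a ↔ ∃ i, z i t = a := by
    rw [ht, isRoot_prod]
    simp only [Finset.mem_univ, true_and, root_X_sub_C]
  have hhigh (i : n) (hi : d i ≠ 0) : ∀ᶠ t in l, -conj (z i t) = z i t := by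
    refine eventually_neg_conj_eq_self hconj (hd i) (fun j => hsimple i j hi) hlim ?_
    filter_upwards [hz] with t ht
    exact (isRoot_iff ht _).1 (hsymm t _ ((isRoot_iff ht _).2 ⟨i, rfl⟩))
  have hcase (i : n) : ∀ᶠ t in l, z i t = ζ t → -conj (ζ t) = ζ t := by
    by_cases hi : d i = 0
    · obtain ⟨w, hw⟩ := hlow i hi
      have hdisj := Metric.disjoint_nhds_cobounded w
      filter_upwards [eventually_ne_of_disjoint hw hζ hdisj] with t ht hzt
      exact absurd hzt ht
    · filter_upwards [hhigh i hi] with t ht hzt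
      rwa [hzt] at ht
  filter_upwards [hz, hroot, eventually_all.2 hcase] with t ht htr htc
  obtain ⟨i, hi⟩ := (isRoot_iff ht _).1 htr
  have hre := congrArg Complex.re (htc i hi)
  simp only [Complex.neg_re, Complex.conj_re] at hre
  linarith

end Overdamping

/-! ### Linear algebra -/

section LinearAlgebra

lemma rank_fromBlocks_zero₂₂ {K m m' n n' : Type*} [Field K] [Fintype m] [Fintype n]
    [Finite m'] [Finite n'] (A : Matrix n' m K) (G : Matrix n' n K) {F : Matrix m' m K}
    (hF : Function.Injective F.mulVec) :
    (Matrix.fromBlocks A G F 0).rank = Fintype.card m + G.rank := by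
  let incl : (n → K) →ₗ[K] (m ⊕ n → K) :=
    (LinearEquiv.sumArrowLequivProdArrow m n K K).symm.toLinearMap ∘ₗ LinearMap.inr K _ _
  have hincl : Function.Injective incl :=
    (LinearEquiv.injective (LinearEquiv.sumArrowLequivProdArrow m n K K).symm).comp
      LinearMap.inr_injective
  have hincl_apply (y : n → K) : incl y = Sum.elim (0 : m → K) y := rfl
  have hker : LinearMap.ker (Matrix.fromBlocks A G F 0).mulVecLin =
      (LinearMap.ker G.mulVecLin).map incl := by
    ext z
    obtain ⟨x, y, rfl⟩ : ∃ x y, z = Sum.elim x y := ⟨_, _, (Sum.elim_comp_inl_inr z).symm⟩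
    have hsplit : (Matrix.fromBlocks A G F 0).mulVec (Sum.elim x y) = 0 ↔
        A.mulVec x + G.mulVec y = 0 ∧ F.mulVec x = 0 := by
      rw [Matrix.fromBlocks_mulVec]
      simp [funext_iff]
    have hF0 : F.mulVec x = 0 ↔ x = 0 := by rw [← hF.eq_iff, Matrix.mulVec_zero]
    simp only [LinearMap.mem_ker, Matrix.mulVecLin_apply, hsplit, hF0, Submodule.mem_map,
      hincl_apply, Sum.elim_eq_iff]
    constructor
    · rintro ⟨h, rfl⟩
      exact ⟨y, by simpa using h, rfl, rfl⟩
    · rintro ⟨y, hy, rfl, rfl⟩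
      simpa using hy
  have hblock := LinearMap.finrank_range_add_finrank_ker (Matrix.fromBlocks A G F 0).mulVecLin
  have hG := LinearMap.finrank_range_add_finrank_ker G.mulVecLin
  rw [hker, ← (Submodule.equivMapOfInjective incl hincl _).finrank_eq] at hblock
  simp only [Module.finrank_fintype_fun_eq_card, Fintype.card_sum] at hblock hG
  rw [Matrix.rank, Matrix.rank]
  omega

lemma rank_losslessBlock_fromBlocks {m k : Type*} [Fintype m] [Fintype k] (A : Matrix m m ℂ)
    {F : Matrix k m ℂ} {d : m → ℂ}
    (hF : Function.Injective (F.submatrix id ((↑) : {i // d i = 0} → m)).mulVec) :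
    (losslessBlock (Matrix.fromBlocks A F.conjTranspose F 0) (Sum.elim d 0)).rank =
      2 * Fintype.card {i // d i = 0} := by
  let F₀ : Matrix k {i // d i = 0} ℂ := F.submatrix id (↑)
  let A₀ : Matrix {i // d i = 0} {i // d i = 0} ℂ := A.submatrix (↑) (↑)
  let e : {a // Sum.elim d 0 a = 0} ≃ {i // d i = 0} ⊕ k :=
    Equiv.subtypeSum.trans ((Equiv.refl _).sumCongr (Equiv.subtypeUnivEquiv fun _ => rfl))
  have hblock : losslessBlock (Matrix.fromBlocks A F.conjTranspose F 0) (Sum.elim d 0) =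
      (Matrix.fromBlocks A₀ F₀.conjTranspose F₀ 0).submatrix e e := by
    ext ⟨a | a, ha⟩ ⟨b | b, hb⟩ <;> rfl
  have hrank : F₀.rank = Fintype.card {i // d i = 0} := by
    rw [Matrix.rank, LinearMap.finrank_range_of_inj hF, Module.finrank_fintype_fun_eq_card]
  rw [hblock, Matrix.rank_submatrix, rank_fromBlocks_zero₂₂ _ _ hF]
  open scoped ComplexOrder in rw [Matrix.rank_conjTranspose, hrank]
  omega

lemma eq_of_nodup_roots_charpoly_restrict_range {K V ι : Type*} [Field K] [AddCommGroup V]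
    [Module K V] [FiniteDimensional K V] [Finite ι] {f : Module.End K V}
    (hf : (f.restrict (p := LinearMap.range f) (q := LinearMap.range f)
      fun v _ => LinearMap.mem_range_self f v).charpoly.roots.Nodup)
    {x : ι → V} {d : ι → K} (hx : LinearIndependent K x) (hd : ∀ i, f (x i) = d i • x i)
    {i j : ι} (hi : d i ≠ 0) (hij : d j = d i) : j = i := by
  classical
  set g := f.restrict (p := LinearMap.range f) (q := LinearMap.range f)
    fun v _ => LinearMap.mem_range_self f v
  have hmem (k : {k // d k = d i}) : x k ∈ LinearMap.range f :=
    ⟨(d i)⁻¹ • x k, by rw [map_smul, hd, k.2, inv_smul_smul₀ hi]⟩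
  have hmemE (k : {k // d k = d i}) : ⟨x k, hmem k⟩ ∈ Module.End.eigenspace g (d i) := by
    rw [Module.End.mem_eigenspace_iff]
    exact Subtype.ext ((hd k).trans (by rw [k.2]; rfl))
  let y (k : {k // d k = d i}) : Module.End.eigenspace g (d i) := ⟨⟨x k, hmem k⟩, hmemE k⟩
  have hy : LinearIndependent K y :=
    LinearIndependent.of_comp
      ((LinearMap.range f).subtype ∘ₗ (Module.End.eigenspace g (d i)).subtype)
      (hx.comp _ Subtype.val_injective)
  have := Fintype.ofFinite {k // d k = d i}
  have hmult : g.charpoly.rootMultiplicity (d i) ≤ 1 := by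
    rw [← count_roots]
    exact Multiset.nodup_iff_count_le_one.1 hf (d i)
  have hcard : Fintype.card {k // d k = d i} ≤ 1 :=
    hy.fintype_card_le_finrank.trans ((g.finrank_eigenspace_le (d i)).trans hmult)
  exact congrArg Subtype.val (Fintype.card_le_one_iff.1 hcard ⟨j, hij⟩ ⟨i, rfl⟩)

lemma im_eq_zero_and_card_ne_zero_of_isHermitian {m ι : Type*} [Fintype m] [DecidableEq m]
    [Fintype ι] {M : Matrix m m ℂ} (hM : M.IsHermitian) {w : ι → ℂ}
    (hw : M.charpoly = ∏ i, (X - C (w i))) :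
    (∀ i, (w i).im = 0) ∧ Fintype.card {i // w i ≠ 0} = M.rank := by
  obtain ⟨e, he⟩ := exists_equiv_of_prod_X_sub_C_eq (hw.symm.trans hM.charpoly_eq)
  refine ⟨fun i => by simp [← he], ?_⟩
  rw [hM.rank_eq_card_non_zero_eigs]
  exact Fintype.card_congr (e.subtypeEquiv fun i => by simp [← he])

lemma isRoot_charpoly_neg_map {K n : Type*} [CommRing K] [Fintype n] [DecidableEq n]
    {A : Matrix n n K} {f : K →+* K} (hA : A.map f = -A) {z : K} (hz : A.charpoly.IsRoot z) :
    A.charpoly.IsRoot (-f z) := by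
  have hreflect : Matrix.scalar n (-f z) - A = -f.mapMatrix (Matrix.scalar n z - A) := by
    rw [map_sub, RingHom.mapMatrix_apply, RingHom.mapMatrix_apply, hA, Matrix.scalar_apply,
      Matrix.scalar_apply, Matrix.diagonal_map (map_zero f), ← Matrix.diagonal_neg]
    abel
  rw [IsRoot.def, Matrix.eval_charpoly] at hz ⊢
  rw [hreflect, Matrix.det_neg, ← RingHom.map_det, hz, map_zero, mul_zero]

end LinearAlgebra

section UnitaryDiagonalization

/-- `U` is unitary and its columns are eigenvectors of `L` with eigenvalues `d`. -/
structure IsUnitaryDiagonalization {K n : Type*} [Field K] [StarRing K] [Fintype n] [DecidableEq n]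
    (L U : Matrix n n K) (d : n → K) : Prop where
  conjTranspose_mul_self : U.conjTranspose * U = 1
  mul_eq : L * U = U * Matrix.diagonal d

lemma exists_isUnitaryDiagonalization {K n : Type*} [RCLike K] [Fintype n] [DecidableEq n]
    {L : Matrix n n K} (hL : L.IsHermitian) :
    ∃ U d, IsUnitaryDiagonalization L U d := by
  have hU := Unitary.coe_star_mul_self hL.eigenvectorUnitary
  have hspec := hL.spectral_theorem
  rw [Unitary.conjStarAlgAut_apply] at hspec
  refine ⟨hL.eigenvectorUnitary, RCLike.ofReal ∘ hL.eigenvalues, hU, ?_⟩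
  refine (congrArg (· * (hL.eigenvectorUnitary : Matrix n n K)) hspec).trans ?_
  rw [Matrix.mul_assoc, hU, Matrix.mul_one]

namespace IsUnitaryDiagonalization

variable {K n : Type*} [Field K] [StarRing K] [Fintype n] [DecidableEq n]
  {L U : Matrix n n K} {d : n → K}

lemma isUnit (h : IsUnitaryDiagonalization L U d) : IsUnit U :=
  .of_mul_eq_one_right _ h.conjTranspose_mul_self

lemma card_ne_zero [DecidableEq K] (h : IsUnitaryDiagonalization L U d) :
    Fintype.card {i // d i ≠ 0} = L.rank := by
  have hdet : IsUnit U.det := (Matrix.isUnit_iff_isUnit_det U).1 h.isUnit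
  rw [← Matrix.rank_diagonal, ← Matrix.rank_mul_eq_right_of_isUnit_det U _ hdet, ← h.mul_eq,
    Matrix.rank_mul_eq_left_of_isUnit_det U _ hdet]

lemma charpoly_add_smul (h : IsUnitaryDiagonalization L U d) (M : Matrix n n K) (c : K) :
    (M + c • L).charpoly = (U.conjTranspose * M * U + c • Matrix.diagonal d).charpoly := by
  have hconj : U.conjTranspose * ((M + c • L) * U) =
      U.conjTranspose * M * U + c • Matrix.diagonal d := by
    rw [add_mul, Matrix.smul_mul, h.mul_eq, mul_add, Matrix.mul_smul, ← Matrix.mul_assoc,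
      ← Matrix.mul_assoc, h.conjTranspose_mul_self, Matrix.one_mul]
  rw [← hconj, Matrix.charpoly_mul_comm, Matrix.mul_assoc,
    mul_eq_one_comm.1 h.conjTranspose_mul_self, Matrix.mul_one]

lemma mulVec_col (h : IsUnitaryDiagonalization L U d) (i : n) :
    L.mulVec (U.col i) = d i • U.col i := by
  ext a
  have hentry := congrFun (congrFun h.mul_eq a) i
  rw [Matrix.mul_diagonal, mul_comm] at hentry
  exact hentry

lemma linearIndependent_col (h : IsUnitaryDiagonalization L U d) : LinearIndependent K U.col :=
  Matrix.linearIndependent_cols_iff_isUnit.2 h.isUnit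

section NullColumns

variable {κ : Type*} {v : κ → n}

lemma mul_submatrix_eq_zero (h : IsUnitaryDiagonalization L U d) (hv : ∀ k, d (v k) = 0) :
    L * U.submatrix id v = 0 := by
  ext a k
  have hcol := congrFun (h.mulVec_col (v k)) a
  rw [hv, zero_smul] at hcol
  exact hcol

lemma injective_mulVec_submatrix [Fintype κ] (h : IsUnitaryDiagonalization L U d)
    (hv : Function.Injective v) : Function.Injective (U.submatrix id v).mulVec :=
  Matrix.mulVec_injective_iff.2 (h.linearIndependent_col.comp v hv)

end NullColumns

end IsUnitaryDiagonalization

end UnitaryDiagonalization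

/-! ### Real matrices as complex matrices -/

section ToC

variable {l m n : Type*}

lemma toC_mul [Fintype m] (A : Matrix l m ℝ) (B : Matrix m n ℝ) : toC (A * B) = toC A * toC B :=
  Matrix.map_mul (f := Complex.ofRealHom)

lemma toC_one [DecidableEq n] : toC (1 : Matrix n n ℝ) = 1 :=
  Matrix.map_one _ Complex.ofReal_zero Complex.ofReal_one

lemma toC_neg (A : Matrix m n ℝ) : toC (-A) = -toC A :=
  Matrix.map_neg _ Complex.ofReal_neg A

lemma toC_diagonal [DecidableEq n] (d : n → ℝ) :
    toC (Matrix.diagonal d) = Matrix.diagonal fun i => (d i : ℂ) :=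
  Matrix.diagonal_map Complex.ofReal_zero

lemma conjTranspose_toC (A : Matrix m n ℝ) : (toC A).conjTranspose = toC A.transpose := by
  ext i j
  simp [toC]

lemma injective_mulVec_toC [Fintype n] {A : Matrix m n ℝ} (hA : Function.Injective A.mulVec) :
    Function.Injective (toC A).mulVec := by
  have hzero {y : n → ℝ} (hy : A.mulVec y = 0) : y = 0 := hA (hy.trans (A.mulVec_zero).symm)
  refine (injective_iff_map_eq_zero (toC A).mulVecLin).2 fun x hx => ?_
  have hre : A.mulVec (fun i => (x i).re) = 0 := funext fun i => by
    simpa [toC, Matrix.mulVec, dotProduct] using congrArg Complex.re (congrFun hx i)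
  have him : A.mulVec (fun i => (x i).im) = 0 := funext fun i => by
    simpa [toC, Matrix.mulVec, dotProduct] using congrArg Complex.im (congrFun hx i)
  exact funext fun i => Complex.ext (congrFun (hzero hre) i) (congrFun (hzero him) i)

end ToC

/-! ### The system operator -/

section SystemOperator

variable {N : ℕ} {α η θ R : Matrix (Fin N) (Fin N) ℝ}

lemma isUnit_Kp (hα : α.PosDef) : IsUnit (Kp α) := by
  rw [Kp, Matrix.isUnit_nonsing_inv_iff]
  exact isUnit_of_mul_isUnit_left
    ((CFC.sqrt_mul_sqrt_self α hα.posSemidef.nonneg).symm ▸ hα.isUnit)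

lemma isHermitian_Omega (hθ : θ.transpose = -θ) : (Omega α η θ).IsHermitian := by
  have hblock : (Kp α * θ * (Kp α).transpose).transpose = -(Kp α * θ * (Kp α).transpose) := by
    simp [Matrix.transpose_mul, hθ, Matrix.mul_assoc]
  rw [Matrix.IsHermitian, Omega, Matrix.fromBlocks_conjTranspose]
  simp [conjTranspose_toC, hblock, toC_neg]

lemma map_starRingEnd_systemOp (α η θ R : Matrix (Fin N) (Fin N) ℝ) (β : ℝ) :
    (systemOp α η θ R β).map (starRingEnd ℂ) = -systemOp α η θ R β := by
  ext i j
  rcases i with i | i <;> rcases j with j | j <;>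
    simp [systemOp, Omega, lossB, toC, Complex.conj_ofNat]
  ring

lemma isHermitian_lossBlock (α : Matrix (Fin N) (Fin N) ℝ) (hR : R.IsHermitian) :
    (Kp α * R * (Kp α).transpose).IsHermitian :=
  Matrix.isHermitian_mul_mul_conjTranspose (Kp α) hR

lemma rank_lossBlock (hα : α.PosDef) (R : Matrix (Fin N) (Fin N) ℝ) :
    (Kp α * R * (Kp α).transpose).rank = R.rank := by
  have hdet := (Matrix.isUnit_iff_isUnit_det _).1 (isUnit_Kp hα)
  rw [Matrix.rank_mul_eq_left_of_isUnit_det _ _ (by rwa [Matrix.det_transpose]),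
    Matrix.rank_mul_eq_right_of_isUnit_det _ _ hdet]

lemma eq_zero_of_lossBlock_mulVec_eq_zero (hα : α.PosDef) (hη : η.PosSemidef)
    (hker : LinearMap.ker R.mulVecLin ⊓ LinearMap.ker η.mulVecLin = ⊥) {y : Fin N → ℝ}
    (hloss : (Kp α * R * (Kp α).transpose).mulVec y = 0) (hPhi : (Phi α η).mulVec y = 0) :
    y = 0 := by
  have hK := isUnit_Kp hα
  have hRy : R.mulVec ((Kp α).transpose.mulVec y) = 0 := by
    rw [Matrix.mul_assoc, ← Matrix.mulVec_mulVec, ← Matrix.mulVec_mulVec] at hloss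
    exact Matrix.mulVec_injective_of_isUnit hK (hloss.trans (Matrix.mulVec_zero _).symm)
  have hηy : η.mulVec ((Kp α).transpose.mulVec y) = 0 := by
    have hKq : Kq η * Kq η = η := CFC.sqrt_mul_sqrt_self η hη.nonneg
    rw [Phi, ← Matrix.mulVec_mulVec] at hPhi
    rw [← congrArg Matrix.mulVec hKq, ← Matrix.mulVec_mulVec, hPhi, Matrix.mulVec_zero]
  have hKy : (Kp α).transpose.mulVec y = 0 :=
    (Submodule.mem_bot ℝ).1 (hker ▸ Submodule.mem_inf.2 ⟨hRy, hηy⟩)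
  exact Matrix.mulVec_injective_of_isUnit ((Matrix.isUnit_transpose _).2 hK)
    (hKy.trans (Matrix.mulVec_zero _).symm)

/-- The change of basis which acts as `U` on the first summand and trivially on the second one. -/
def rotation (U : Matrix (Fin N) (Fin N) ℝ) : Matrix (Fin N ⊕ Fin N) (Fin N ⊕ Fin N) ℂ :=
  Matrix.fromBlocks (toC U) 0 0 1

/-- The eigenvalues of `lossB` when `d` lists those of its first diagonal block. -/
def lossDiag (d : Fin N → ℝ) : Fin N ⊕ Fin N → ℂ := Sum.elim (fun i => (d i : ℂ)) 0

/-- The frequency operator `Ω` in the basis given by `rotation U`. -/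
noncomputable def rotatedOmega (α η θ U : Matrix (Fin N) (Fin N) ℝ) :
    Matrix (Fin N ⊕ Fin N) (Fin N ⊕ Fin N) ℂ :=
  (rotation U).conjTranspose * Omega α η θ * rotation U

/-- The factor `-iβ` in front of `B` in `A(β)`. -/
def lossCoeff (β : ℝ) : ℂ := -(Complex.I * (β : ℂ))

lemma tendsto_lossCoeff : Tendsto lossCoeff atTop (Bornology.cobounded ℂ) := by
  rw [← tendsto_norm_atTop_iff_cobounded]
  simpa [lossCoeff] using tendsto_abs_atTop_atTop

lemma conj_lossCoeff (β : ℝ) : (starRingEnd ℂ) (lossCoeff β) = -lossCoeff β := by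
  simp [lossCoeff]

lemma conj_lossDiag (d : Fin N → ℝ) (a : Fin N ⊕ Fin N) :
    (starRingEnd ℂ) (lossDiag d a) = lossDiag d a := by
  rcases a with a | a <;> simp [lossDiag]

variable {U : Matrix (Fin N) (Fin N) ℝ} {d : Fin N → ℝ}

lemma isUnitaryDiagonalization_lossB
    (h : IsUnitaryDiagonalization (Kp α * R * (Kp α).transpose) U d) :
    IsUnitaryDiagonalization (lossB α R) (rotation U) (lossDiag d) where
  conjTranspose_mul_self := by
    have hU : (toC U).conjTranspose * toC U = 1 := by
      rw [conjTranspose_toC, ← toC_mul, ← toC_one, ← h.conjTranspose_mul_self,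
        Matrix.conjTranspose_eq_transpose_of_trivial]
    simp [rotation, Matrix.fromBlocks_conjTranspose, Matrix.fromBlocks_multiply, hU]
  mul_eq := by
    have hdiag : Matrix.diagonal (lossDiag d) =
        Matrix.fromBlocks (toC (Matrix.diagonal d)) 0 0 0 := by
      rw [lossDiag, ← Matrix.fromBlocks_diagonal, toC_diagonal]
      simp
    simp [lossB, rotation, hdiag, Matrix.fromBlocks_multiply, ← toC_mul, h.mul_eq]

lemma charpoly_systemOp (h : IsUnitaryDiagonalization (Kp α * R * (Kp α).transpose) U d)
    (η θ : Matrix (Fin N) (Fin N) ℝ) (β : ℝ) :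
    (systemOp α η θ R β).charpoly =
      (rotatedOmega α η θ U + lossCoeff β • Matrix.diagonal (lossDiag d)).charpoly := by
  rw [systemOp, sub_eq_add_neg, ← neg_smul]
  exact (isUnitaryDiagonalization_lossB h).charpoly_add_smul _ _

lemma isHermitian_rotatedOmega (hθ : θ.transpose = -θ) : (rotatedOmega α η θ U).IsHermitian :=
  Matrix.isHermitian_conjTranspose_mul_mul _ (isHermitian_Omega hθ)

lemma rotatedOmega_eq_fromBlocks (α η θ U : Matrix (Fin N) (Fin N) ℝ) :
    ∃ A, rotatedOmega α η θ U =
      Matrix.fromBlocks A (Complex.I • toC (Phi α η * U)).conjTranspose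
        (Complex.I • toC (Phi α η * U)) 0 := by
  refine ⟨(toC U).conjTranspose * (-(2 * Complex.I) • toC (Kp α * θ * (Kp α).transpose)) * toC U,
    ?_⟩
  rw [rotatedOmega, rotation, Omega, Matrix.fromBlocks_conjTranspose, Matrix.fromBlocks_multiply,
    Matrix.fromBlocks_multiply]
  simp only [Matrix.conjTranspose_zero, Matrix.conjTranspose_one, Matrix.zero_mul, Matrix.mul_zero,
    Matrix.one_mul, Matrix.mul_one, add_zero, zero_add]
  congr 1
  · simp [toC_mul, Matrix.conjTranspose_mul, conjTranspose_toC]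
  · rw [Matrix.smul_mul, toC_mul]

lemma rank_losslessBlock_rotatedOmega (hα : α.PosDef) (hη : η.PosSemidef)
    (hker : LinearMap.ker R.mulVecLin ⊓ LinearMap.ker η.mulVecLin = ⊥)
    (h : IsUnitaryDiagonalization (Kp α * R * (Kp α).transpose) U d)
    (θ : Matrix (Fin N) (Fin N) ℝ) :
    (losslessBlock (rotatedOmega α η θ U) (lossDiag d)).rank = 2 * (N - R.rank) := by
  let v : {i // (d i : ℂ) = 0} → Fin N := (↑)
  have hv (k) : d (v k) = 0 := Complex.ofReal_eq_zero.1 k.2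
  have hPhi : Function.Injective (Phi α η * U.submatrix id v).mulVec := by
    refine (injective_iff_map_eq_zero (Matrix.mulVecLin _)).2 fun y hy => ?_
    rw [Matrix.mulVecLin_apply, ← Matrix.mulVec_mulVec] at hy
    have hloss : (Kp α * R * (Kp α).transpose).mulVec ((U.submatrix id v).mulVec y) = 0 := by
      rw [Matrix.mulVec_mulVec, h.mul_submatrix_eq_zero hv, Matrix.zero_mulVec]
    refine h.injective_mulVec_submatrix Subtype.val_injective ?_
    rw [Matrix.mulVec_zero]
    exact eq_zero_of_lossBlock_mulVec_eq_zero hα hη hker hloss hy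
  have hF : Function.Injective ((Complex.I • toC (Phi α η * U)).submatrix id v).mulVec := by
    have hsub : (Complex.I • toC (Phi α η * U)).submatrix id v =
        Complex.I • toC (Phi α η * U.submatrix id v) := rfl
    rw [hsub]
    intro x y hxy
    simp only [Matrix.smul_mulVec] at hxy
    exact injective_mulVec_toC hPhi (smul_right_injective _ Complex.I_ne_zero hxy)
  obtain ⟨A, hA⟩ := rotatedOmega_eq_fromBlocks α η θ U
  rw [hA, lossDiag, rank_losslessBlock_fromBlocks A hF, ← rank_lossBlock hα, ← h.card_ne_zero,
    Fintype.card_subtype_compl, Fintype.card_fin]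
  simp only [Complex.ofReal_eq_zero]
  have := Fintype.card_subtype_le fun i => d i = 0
  rw [Fintype.card_fin] at this
  omega

lemma card_lossDiag_ne_zero (hα : α.PosDef)
    (h : IsUnitaryDiagonalization (Kp α * R * (Kp α).transpose) U d) :
    Fintype.card {a // lossDiag d a ≠ 0} = R.rank := by
  rw [← rank_lossBlock hα, ← h.card_ne_zero]
  have : IsEmpty {a : Fin N // lossDiag d (Sum.inr a) ≠ 0} := ⟨fun a => a.2 rfl⟩
  exact Fintype.card_congr ((Equiv.subtypeSum.trans (Equiv.sumEmpty _ _)).trans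
    (Equiv.subtypeEquivRight fun i => Complex.ofReal_ne_zero))

lemma eq_of_lossDiag_eq (hgen : GenericCondition α R)
    (h : IsUnitaryDiagonalization (Kp α * R * (Kp α).transpose) U d) (a b : Fin N ⊕ Fin N)
    (ha : lossDiag d a ≠ 0) (hab : lossDiag d b = lossDiag d a) : b = a :=
  have hB := isUnitaryDiagonalization_lossB h
  eq_of_nodup_roots_charpoly_restrict_range hgen hB.linearIndependent_col hB.mulVec_col ha hab

end SystemOperator

/-! ### Eigenvalue families -/

section Families

variable {N r : ℕ} {A : ℝ → Matrix (Fin N ⊕ Fin N) (Fin N ⊕ Fin N) ℂ}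
  {W : Matrix (Fin N ⊕ Fin N) (Fin N ⊕ Fin N) ℂ} {d : Fin N ⊕ Fin N → ℂ}
  {ζ : Fin (2 * N) → ℝ → ℂ}

lemma card_fin_le_val {n k : ℕ} (hk : k ≤ n) : Fintype.card {j : Fin n // k ≤ (j : ℕ)} = n - k := by
  have hlt : Fintype.card {j : Fin n // (j : ℕ) < k} = k := by
    rw [Fintype.card_subtype, Fin.card_filter_val_lt, min_eq_right hk]
  have hcompl := Fintype.card_subtype_compl fun j : Fin n => (j : ℕ) < k
  simpa only [not_lt, hlt, Fintype.card_fin] using hcompl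

lemma exists_isEigenvalueFamily
    (hA : ∀ β, (A β).charpoly = (W + lossCoeff β • Matrix.diagonal d).charpoly)
    (hcard : Fintype.card {a // d a ≠ 0} = r) : ∃ ζ, IsEigenvalueFamily A r ζ := by
  obtain ⟨z, hz, hscaled, hlow⟩ := exists_roots_charpoly_add_smul_diagonal tendsto_lossCoeff W d
  have hr : r ≤ 2 * N := by
    calc
    r ≤ Fintype.card (Fin N ⊕ Fin N) := hcard ▸ Fintype.card_subtype_le _
    _ = 2 * N := by simp [two_mul]
  have hcount : Fintype.card {j : Fin (2 * N) // (j : ℕ) < r} = Fintype.card {a // d a ≠ 0} := by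
    rw [hcard, Fintype.card_subtype, Fin.card_filter_val_lt, min_eq_right hr]
  obtain ⟨e, he⟩ := exists_equiv_forall_iff (by simp [two_mul]) hcount
  refine ⟨fun j => z (e j), hz.mono fun β hβ => ?_, fun j hj => ?_, fun j hj => ?_⟩
  · rw [hA, hβ]
    exact (e.prod_comp fun a => X - C (z a β)).symm
  · exact tendsto_norm_atTop_iff_cobounded.2
      (tendsto_cobounded_of_tendsto_inv_mul tendsto_lossCoeff ((he j).2 hj) (hscaled (e j)))
  · exact hlow _ (not_not.1 (mt (he j).1 hj.not_gt))

namespace IsEigenvalueFamily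

lemma eventually_isRoot (hζ : IsEigenvalueFamily A r ζ) (j : Fin (2 * N)) :
    ∀ᶠ β in atTop, (A β).charpoly.IsRoot (ζ j β) := by
  filter_upwards [hζ.charpoly_eq] with β hβ
  rw [hβ, isRoot_prod]
  exact ⟨j, Finset.mem_univ j, root_X_sub_C.2 rfl⟩

lemma eventually_re_eq_zero (hζ : IsEigenvalueFamily A r ζ)
    (hA : ∀ β, (A β).charpoly = (W + lossCoeff β • Matrix.diagonal d).charpoly)
    (hconj : ∀ β, (A β).map (starRingEnd ℂ) = -A β) (hd : ∀ a, (starRingEnd ℂ) (d a) = d a)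
    (hsimple : ∀ a b, d a ≠ 0 → d b = d a → b = a) :
    ∀ᶠ β in atTop, ∀ j : Fin (2 * N), (j : ℕ) < r → (ζ j β).re = 0 := by
  simp only [eventually_all]
  intro j hj
  refine eventually_re_eq_zero_of_tendsto_cobounded (W := W) tendsto_lossCoeff conj_lossCoeff hd
    hsimple (fun β z hz => ?_) (tendsto_norm_atTop_iff_cobounded.1 (hζ.high j hj)) ?_
  · rw [← hA] at hz ⊢
    exact isRoot_charpoly_neg_map (hconj β) hz
  · simpa only [hA] using hζ.eventually_isRoot j

lemma exists_tendsto_low (hζ : IsEigenvalueFamily A r ζ)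
    (hA : ∀ β, (A β).charpoly = (W + lossCoeff β • Matrix.diagonal d).charpoly) :
    ∃ w : {j : Fin (2 * N) // r ≤ (j : ℕ)} → ℂ,
      (∀ j : {j : Fin (2 * N) // r ≤ (j : ℕ)}, Tendsto (ζ j) atTop (𝓝 (w j))) ∧
      ∏ j, (X - C (w j)) = (losslessBlock W d).charpoly := by
  choose w hw using fun j : {j : Fin (2 * N) // r ≤ (j : ℕ)} => hζ.low j j.2
  have hprod (x : ℂ) : Tendsto (fun β => (∏ a : {a // ¬d a = 0}, -(lossCoeff β * d a))⁻¹ *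
      ∏ j, (x - ζ j β)) atTop (𝓝 ((losslessBlock W d).charpoly.eval x)) := by
    refine (tendsto_smul_eval_charpoly_add_smul_diagonal tendsto_lossCoeff W d x).congr' ?_
    filter_upwards [hζ.charpoly_eq] with β hβ
    rw [← hA, hβ, eval_prod]
    simp only [eval_sub, eval_X, eval_C]
  exact ⟨w, hw, prod_X_sub_C_eq_of_tendsto_smul_prod (Matrix.charpoly_monic _) hprod hw
    fun j hj => tendsto_norm_atTop_iff_cobounded.1 (hζ.high j (not_le.1 hj))⟩

lemma exists_tendsto_low_real (hζ : IsEigenvalueFamily A r ζ)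
    (hA : ∀ β, (A β).charpoly = (W + lossCoeff β • Matrix.diagonal d).charpoly)
    (hW : (losslessBlock W d).IsHermitian) :
    ∃ w : {j : Fin (2 * N) // r ≤ (j : ℕ)} → ℝ,
      (∀ j : {j : Fin (2 * N) // r ≤ (j : ℕ)}, Tendsto (ζ j) atTop (𝓝 (w j : ℂ))) ∧
      Fintype.card {j // w j ≠ 0} = (losslessBlock W d).rank := by
  obtain ⟨w, hw, hwprod⟩ := hζ.exists_tendsto_low hA
  obtain ⟨him, hcard⟩ := im_eq_zero_and_card_ne_zero_of_isHermitian hW hwprod.symm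
  have hre (j) : ((w j).re : ℂ) = w j := Complex.ext rfl (him j).symm
  refine ⟨fun j => (w j).re, fun j => by simpa only [hre] using hw j, ?_⟩
  simpa only [← Complex.ofReal_ne_zero, hre] using hcard

lemma comp_perm (hζ : IsEigenvalueFamily A r ζ) {σ : Equiv.Perm (Fin (2 * N))}
    (hσ : ∀ j, r ≤ (σ j : ℕ) ↔ r ≤ (j : ℕ)) : IsEigenvalueFamily A r fun j => ζ (σ j) where
  charpoly_eq := hζ.charpoly_eq.mono fun β hβ =>
    hβ.trans (Equiv.prod_comp σ fun j => X - C (ζ j β)).symm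
  high j hj := hζ.high _ (lt_of_not_ge fun h => hj.not_ge ((hσ j).1 h))
  low j hj := hζ.low _ ((hσ j).2 hj)

lemma exists_refined_perm (hζ : IsEigenvalueFamily A r ζ)
    (hA : ∀ β, (A β).charpoly = (W + lossCoeff β • Matrix.diagonal d).charpoly)
    (hW : (losslessBlock W d).IsHermitian) (hrN : r ≤ N)
    (hrank : (losslessBlock W d).rank = 2 * (N - r)) :
    ∃ σ : Equiv.Perm (Fin (2 * N)), IsEigenvalueFamily A r (fun j => ζ (σ j)) ∧
      IsRefinedIndexing r (fun j => ζ (σ j)) := by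
  obtain ⟨w, hw, hcard⟩ := hζ.exists_tendsto_low_real hA hW
  have hcount : Fintype.card {j : {j : Fin (2 * N) // r ≤ (j : ℕ)} // 2 * r ≤ (j : ℕ)} =
      Fintype.card {j // w j ≠ 0} := by
    rw [hcard, hrank, Nat.mul_sub, ← card_fin_le_val (Nat.mul_le_mul_left 2 hrN)]
    exact Fintype.card_congr (Equiv.subtypeSubtypeEquivSubtype
      (p := fun j : Fin (2 * N) => r ≤ (j : ℕ)) (q := fun j => 2 * r ≤ (j : ℕ))
      fun h => by omega)
  obtain ⟨e, he⟩ := exists_equiv_forall_iff rfl hcount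
  have hlow (j : Fin (2 * N)) (hj : r ≤ (j : ℕ)) :
      Tendsto (ζ (Equiv.Perm.ofSubtype e j)) atTop (𝓝 (w (e ⟨j, hj⟩) : ℂ)) := by
    rw [Equiv.Perm.ofSubtype_apply_of_mem e hj]
    exact hw _
  refine ⟨Equiv.Perm.ofSubtype e, hζ.comp_perm fun j => ?_, ?_, ?_⟩
  · exact Equiv.Perm.ofSubtype_apply_mem_iff_mem (p := fun j : Fin (2 * N) => r ≤ (j : ℕ)) e j
  · intro j hj hj'
    have hzero : w (e ⟨j, hj⟩) = 0 := not_not.1 (mt (he ⟨j, hj⟩).1 hj'.not_ge)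
    simpa only [hzero, Complex.ofReal_zero] using hlow j hj
  · intro j hj
    have hrj : r ≤ (j : ℕ) := by omega
    exact ⟨_, Complex.ofReal_ne_zero.2 ((he ⟨j, hrj⟩).2 hj), hlow j hrj⟩

end IsEigenvalueFamily

namespace IsRefinedIndexing

lemma eventually_re_ne_zero (href : IsRefinedIndexing r ζ)
    (hreal : ∀ j : Fin (2 * N), r ≤ (j : ℕ) → ∃ ρ : ℝ, Tendsto (ζ j) atTop (𝓝 (ρ : ℂ))) :
    ∀ᶠ β in atTop, ∀ j : Fin (2 * N), 2 * r ≤ (j : ℕ) → (ζ j β).re ≠ 0 := by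
  simp only [eventually_all]
  intro j hj
  obtain ⟨ρ, hρ, hζρ⟩ := href.limit_ne_zero j hj
  obtain ⟨ρ', hζρ'⟩ := hreal j (by omega)
  obtain rfl := tendsto_nhds_unique hζρ hζρ'
  exact ((Complex.continuous_re.tendsto _).comp hζρ).eventually_ne (Complex.ofReal_ne_zero.1 hρ)

lemma tendsto_re (href : IsRefinedIndexing r ζ) (j : Fin (2 * N)) (hj : r ≤ (j : ℕ))
    (hj' : (j : ℕ) < 2 * r) : Tendsto (fun β => (ζ j β).re) atTop (𝓝 0) :=
  (Complex.continuous_re.tendsto 0).comp (href.limit_zero j hj hj')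

end IsRefinedIndexing

end Families

end SelectiveOverdamping

open SelectiveOverdamping in
theorem mainTheorem1_general {N : ℕ} (α η θ R : Matrix (Fin N) (Fin N) ℝ)
    (hα : α.PosDef) (hR : R.IsHermitian) :
    (∃ ζ : Fin (2 * N) → ℝ → ℂ, IsEigenvalueFamily (systemOp α η θ R) R.rank ζ) ∧
    (GenericCondition α R →
      ∀ ζ : Fin (2 * N) → ℝ → ℂ, IsEigenvalueFamily (systemOp α η θ R) R.rank ζ →
        ∀ᶠ β in atTop, ∀ j : Fin (2 * N), (j : ℕ) < R.rank → (ζ j β).re = 0) ∧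
    (η.PosSemidef → θ.transpose = -θ →
      LinearMap.ker R.mulVecLin ⊓ LinearMap.ker η.mulVecLin = ⊥ →
      ∀ ζ : Fin (2 * N) → ℝ → ℂ, IsEigenvalueFamily (systemOp α η θ R) R.rank ζ →
        (∃ σ : Equiv.Perm (Fin (2 * N)),
          IsEigenvalueFamily (systemOp α η θ R) R.rank (fun j => ζ (σ j)) ∧
          IsRefinedIndexing R.rank (fun j => ζ (σ j))) ∧
        (IsRefinedIndexing R.rank ζ →
          (∀ᶠ β in atTop, ∀ j : Fin (2 * N), 2 * R.rank ≤ (j : ℕ) → (ζ j β).re ≠ 0) ∧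
          (∀ j : Fin (2 * N), R.rank ≤ (j : ℕ) → (j : ℕ) < 2 * R.rank →
            Tendsto (fun β => (ζ j β).re) atTop (𝓝 0)))) := by
  obtain ⟨U, d, hUd⟩ := exists_isUnitaryDiagonalization (isHermitian_lossBlock α hR)
  have hA := charpoly_systemOp hUd η θ
  refine ⟨exists_isEigenvalueFamily hA (card_lossDiag_ne_zero hα hUd), fun hgen ζ hζ => ?_,
    fun hη hθ hker ζ hζ => ?_⟩
  · exact hζ.eventually_re_eq_zero hA (map_starRingEnd_systemOp α η θ R) (conj_lossDiag d)
      (eq_of_lossDiag_eq hgen hUd)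
  · have hW : (losslessBlock (rotatedOmega α η θ U) (lossDiag d)).IsHermitian :=
      (isHermitian_rotatedOmega hθ).submatrix _
    have hrank := rank_losslessBlock_rotatedOmega hα hη hker hUd θ
    obtain ⟨w, hw, -⟩ := hζ.exists_tendsto_low_real hA hW
    exact ⟨hζ.exists_refined_perm hA hW R.rank_le_height hrank, fun href =>
      ⟨href.eventually_re_ne_zero fun j hj => ⟨_, hw ⟨j, hj⟩⟩, href.tendsto_re⟩⟩

open SelectiveOverdamping in
theorem mainTheorem1 {N : ℕ} (α η θ R : Matrix (Fin N) (Fin N) ℝ)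
    (hα : α.PosDef) (hη : η.PosSemidef) (hθ : θ.transpose = -θ) (hR : R.PosSemidef)
    (hrank : 0 < R.rank) (hgen : GenericCondition α R) :
    -- the eigenvalue functions exist
    (∃ ζ : Fin (2 * N) → ℝ → ℂ, IsEigenvalueFamily (systemOp α η θ R) R.rank ζ) ∧
    -- the high-loss eigenvalues are overdamped
    (∀ ζ : Fin (2 * N) → ℝ → ℂ, IsEigenvalueFamily (systemOp α η θ R) R.rank ζ →
      ∀ᶠ β in atTop, ∀ j : Fin (2 * N), (j : ℕ) < R.rank → (ζ j β).re = 0) ∧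
    -- the low-loss eigenvalues
    (LinearMap.ker R.mulVecLin ⊓ LinearMap.ker η.mulVecLin = ⊥ →
      ∀ ζ : Fin (2 * N) → ℝ → ℂ, IsEigenvalueFamily (systemOp α η θ R) R.rank ζ →
        -- they can be reindexed in the refined way
        (∃ σ : Equiv.Perm (Fin (2 * N)),
          IsEigenvalueFamily (systemOp α η θ R) R.rank (fun j => ζ (σ j)) ∧
          IsRefinedIndexing R.rank (fun j => ζ (σ j))) ∧
        -- and any such indexing has the asserted properties
        (IsRefinedIndexing R.rank ζ →
          (∀ᶠ β in atTop, ∀ j : Fin (2 * N), 2 * R.rank ≤ (j : ℕ) → (ζ j β).re ≠ 0) ∧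
          (∀ j : Fin (2 * N), R.rank ≤ (j : ℕ) → (j : ℕ) < 2 * R.rank →
            Tendsto (fun β => (ζ j β).re) atTop (𝓝 0)))) := by
  obtain ⟨hexists, hhigh, hlow⟩ := mainTheorem1_general α η θ R hα hR.isHermitian
  exact ⟨hexists, hhigh hgen, hlow hη hθ⟩
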